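/- Let $E$ be a real Banach lattice. For $S\subseteq E$ let $\mathrm{sol}(S)=\{x\in E:\ |x|\le |y| \text{ for some } y\in S\}$ be its solid hull. A net $(x_\alpha)$ in $E$ is uaw-convergent to $x\in E$, written $x_\alpha\overset{uaw}{\longrightarrow}x$, if $|x_\alpha-x|\wedge u\to 0$ weakly for every $u\ge 0$ in $E$. A norm bounded set $A\subseteq E$ is uaw-compact (respectively, relatively uaw-compact) if every net in $A$ has a subnet that is uaw-convergent to a point of $A$ (respectively, of $E$). A norm bounded set $S\subseteq E$ is L-weakly compact if $\|x_n\|\to 0$ for every disjoint sequence $(x_n)$ in $\mathrm{sol}(S)$. The space $E$ has the positive Schur property if every weakly null sequence of positive elements of $E$ is norm null. Then the following statements are equivalent: 1. $E$ has the positive Schur property. 2. Every relatively weakly compact subset of $E$ is L-weakly compact. 3. For every relatively weakly compact $S\subseteq E$ and every net $(x_\alpha)$ in $\mathrm{sol}(S)$ with $x_\alpha\overset{uaw}{\longrightarrow}0$, we have $\|x_\alpha\|\to 0$. 4. For every relatively weakly compact $S\subseteq E$ and every sequence $(x_n)$ in $\mathrm{sol}(S)$ with $x_n\overset{uaw}{\longrightarrow}0$,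 we have $\|x_n\|\to 0$. 5. For every relatively weakly compact $S\subseteq E$, every uaw-compact subset $A$ of $\mathrm{sol}(S)$ is norm compact. 6. For every relatively weakly compact $S\subseteq E$, every relatively uaw-compact subset $A$ of $\mathrm{sol}(S)$ is relatively norm compact. -/

import Mathlib

open Filter Topology

universe u v

/-!
A (real) Banach lattice is given by the Mathlib classes
`NormedAddCommGroup E`, `NormedSpace ℝ E`, `CompleteSpace E`, `Lattice E`, `IsOrderedAddMonoid E`,
`IsOrderedModule ℝ E` and `HasSolidNorm E` (that is, `|x| ≤ |y|` implies `‖x‖ ≤ ‖y‖`).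
The solid hull `sol(S) = {x | ∃ y ∈ S, |x| ≤ |y|}` is Mathlib's
`LatticeOrderedAddCommGroup.solidClosure S`, and the weak topology is that of `WeakSpace ℝ E`.
-/

namespace BanachLattice

/-- `x i` converges weakly to `a` along the filter `l` (for a net, `l = atTop`). -/
def WeakTendsto {E : Type*} [NormedAddCommGroup E] [NormedSpace ℝ E]
    {ι : Type*} (x : ι → E) (l : Filter ι) (a : E) : Prop :=
  Tendsto (fun i => toWeakSpace ℝ E (x i)) l (𝓝 (toWeakSpace ℝ E a))

/-- Unbounded absolutely weak convergence: `|x i - a| ⊓ w` is weakly null for every `w ≥ 0`. -/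
def UawTendsto {E : Type*} [NormedAddCommGroup E] [NormedSpace ℝ E] [Lattice E]
    {ι : Type*} (x : ι → E) (l : Filter ι) (a : E) : Prop :=
  ∀ w : E, 0 ≤ w → WeakTendsto (fun i => |x i - a| ⊓ w) l 0

/-- A set whose closure in the weak topology is weakly compact. -/
def IsRelWeaklyCompact {E : Type*} [NormedAddCommGroup E] [NormedSpace ℝ E] (S : Set E) : Prop :=
  IsCompact (closure (toWeakSpace ℝ E '' S))

/-- A norm bounded set `S` such that every disjoint sequence in its solid hull is norm null. -/
def IsLWeaklyCompact {E : Type*} [NormedAddCommGroup E] [Lattice E] (S : Set E) : Prop :=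
  Bornology.IsBounded S ∧
    ∀ x : ℕ → E, (∀ n, x n ∈ LatticeOrderedAddCommGroup.solidClosure S) →
      (∀ m n, m ≠ n → |x m| ⊓ |x n| = 0) → Tendsto x atTop (𝓝 0)

/-- The positive Schur property: weakly null sequences of positive elements are norm null. -/
def PositiveSchurProperty (E : Type*) [NormedAddCommGroup E] [NormedSpace ℝ E] [Lattice E] :
    Prop :=
  ∀ x : ℕ → E, (∀ n, 0 ≤ x n) → WeakTendsto x atTop 0 → Tendsto x atTop (𝓝 0)

/-- The net `x` has a subnet `x ∘ φ` that is uaw-convergent to `a`. -/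
def HasSubnetUawTendsto {E : Type u} [NormedAddCommGroup E] [NormedSpace ℝ E] [Lattice E]
    {ι : Type u} [Preorder ι] (x : ι → E) (a : E) : Prop :=
  ∃ (κ : Type u) (_ : Preorder κ) (_ : IsDirected κ (· ≤ ·)) (_ : Nonempty κ) (φ : κ → ι),
    Tendsto φ atTop atTop ∧ UawTendsto (x ∘ φ) atTop a

/-- A norm bounded set in which every net has a subnet that is uaw-convergent to a point of the
set. Nets indexed by directed sets in the universe of `E` determine compactness. -/
def IsUawCompact {E : Type u} [NormedAddCommGroup E] [NormedSpace ℝ E] [Lattice E]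
    (A : Set E) : Prop :=
  Bornology.IsBounded A ∧
    ∀ (ι : Type u) [Preorder ι] [IsDirected ι (· ≤ ·)] [Nonempty ι] (x : ι → E),
      (∀ i, x i ∈ A) → ∃ a ∈ A, HasSubnetUawTendsto x a

/-- A norm bounded set in which every net has a subnet that is uaw-convergent in `E`. -/
def IsRelUawCompact {E : Type u} [NormedAddCommGroup E] [NormedSpace ℝ E] [Lattice E]
    (A : Set E) : Prop :=
  Bornology.IsBounded A ∧
    ∀ (ι : Type u) [Preorder ι] [IsDirected ι (· ≤ ·)] [Nonempty ι] (x : ι → E),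
      (∀ i, x i ∈ A) → ∃ a : E, HasSubnetUawTendsto x a

end BanachLattice

/-!
Let `E` have the positive Schur property, let `S` be relatively weakly compact and let `x n` be a
disjoint sequence with `|x n| ≤ |y n|`, `y n ∈ S`. A positive functional `f` restricted to the band
generated by `x n` is a functional `f n`, and by disjointness `∑ n, f n |z| ≤ f |z|` for every `z`.
If `|g n| ≤ f n`, then `z ↦ (g n z)` is a bounded operator from `E` to `ℓ¹`, so the Schur property
of `ℓ¹` gives `g n (y n) → 0`; choosing `g n` norming `|y n|` on the band yields `f |x n| → 0`.
Hence `|x n|` is weakly null, and so norm null.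

Conversely, L-weak compactness of singletons makes the norm order continuous, and an L-weakly
compact set is contained, up to arbitrarily small norm, in an order interval `[-w, w]`. On such a
set uaw-convergence is norm convergence, since `|x| ⊓ w` is then weakly null and order bounded,
hence norm null. Positive weakly null sequences are uaw-null, which leads back to the positive
Schur property.
-/

namespace BanachLattice

section WeakTopology

variable {E : Type*} [NormedAddCommGroup E] [NormedSpace ℝ E]

theorem topDualPairing_flip_injective : Function.Injective (topDualPairing ℝ E).flip := by
  intro a b hab
  by_contra hne
  obtain ⟨f, hf⟩ := SeparatingDual.exists_separating_of_ne (R := ℝ) hne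
  exact hf (LinearMap.congr_fun hab f)

instance : T2Space (WeakSpace ℝ E) :=
  (WeakBilin.isEmbedding topDualPairing_flip_injective).t2Space

theorem continuous_eval_weakSpace (f : E →L[ℝ] ℝ) :
    Continuous fun x : WeakSpace ℝ E => f ((toWeakSpace ℝ E).symm x) :=
  WeakBilin.eval_continuous (topDualPairing ℝ E).flip f

variable {ι κ : Type*} {x : ι → E} {l : Filter ι} {a : E}

theorem weakTendsto_iff :
    WeakTendsto x l a ↔ ∀ f : E →L[ℝ] ℝ, Tendsto (fun i => f (x i)) l (𝓝 (f a)) :=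
  WeakBilin.tendsto_iff_forall_eval_tendsto _ topDualPairing_flip_injective

theorem WeakTendsto.comp {φ : κ → ι} {m : Filter κ} (h : WeakTendsto x l a)
    (hφ : Tendsto φ m l) : WeakTendsto (x ∘ φ) m a :=
  Tendsto.comp (g := fun i => toWeakSpace ℝ E (x i)) h hφ

theorem weakTendsto_of_tendsto (h : Tendsto x l (𝓝 a)) : WeakTendsto x l a :=
  ((toWeakSpaceCLM ℝ E).continuous.tendsto a).comp h

theorem WeakTendsto.eq_of_tendsto {b : E} [l.NeBot] (hw : WeakTendsto x l a)
    (h : Tendsto x l (𝓝 b)) : b = a :=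
  (toWeakSpace ℝ E).injective (tendsto_nhds_unique (weakTendsto_of_tendsto h) hw)

theorem isRelWeaklyCompact_insert_range {x : ℕ → E} (h : WeakTendsto x atTop a) :
    IsRelWeaklyCompact (insert a (Set.range x)) := by
  refine (Tendsto.isCompact_insert_range h).closure_of_subset ?_
  rw [Set.image_insert_eq, ← Set.range_comp]
  rfl

theorem isRelWeaklyCompact_singleton (a : E) : IsRelWeaklyCompact {a} := by
  rw [IsRelWeaklyCompact, Set.image_singleton, closure_singleton]
  exact isCompact_singleton

theorem IsRelWeaklyCompact.isBounded {S : Set E} (hS : IsRelWeaklyCompact S) :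
    Bornology.IsBounded S := by
  obtain ⟨C, hC⟩ : ∃ C, ∀ y : S, ‖NormedSpace.inclusionInDoubleDual ℝ E (y : E)‖ ≤ C := by
    refine banach_steinhaus fun f => ?_
    obtain ⟨C, hC⟩ := (hS.image (continuous_eval_weakSpace f)).isBounded.exists_norm_le
    exact ⟨C, fun y => hC _ ⟨_, subset_closure ⟨y, y.2, rfl⟩, rfl⟩⟩
  exact isBounded_iff_forall_norm_le.2 ⟨C, fun y hy =>
    ((NormedSpace.inclusionInDoubleDualLi ℝ (E := E)).norm_map y).symm.trans_le (hC ⟨y, hy⟩)⟩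

end WeakTopology

section LatticeOrderedGroup

variable {E : Type*} [AddCommGroup E] [Lattice E]

theorem inf_eq_zero_of_le {a b c d : E} (ha : 0 ≤ a) (hb : 0 ≤ b) (hac : a ≤ c) (hbd : b ≤ d)
    (h : c ⊓ d = 0) : a ⊓ b = 0 :=
  le_antisymm (h ▸ inf_le_inf hac hbd) (le_inf ha hb)

variable [IsOrderedAddMonoid E] {a b c z : E}

theorem inf_add_le_add_inf (hz : 0 ≤ z) (ha : 0 ≤ a) (hb : 0 ≤ b) :
    z ⊓ (a + b) ≤ z ⊓ a + z ⊓ b := by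
  rw [inf_add, add_inf, add_inf]
  refine le_inf (le_inf ?_ ?_) (le_inf ?_ inf_le_right)
  · exact inf_le_left.trans (le_add_of_nonneg_left hz)
  · exact inf_le_left.trans (le_add_of_nonneg_right hb)
  · exact inf_le_left.trans (le_add_of_nonneg_left ha)

theorem inf_add_eq_zero (hz : 0 ≤ z) (ha : 0 ≤ a) (hb : 0 ≤ b) (hza : z ⊓ a = 0)
    (hzb : z ⊓ b = 0) : z ⊓ (a + b) = 0 :=
  le_antisymm ((inf_add_le_add_inf hz ha hb).trans_eq (by rw [hza, hzb, add_zero]))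
    (le_inf hz (add_nonneg ha hb))

theorem inf_sum_eq_zero {ι : Type*} {s : Finset ι} {f : ι → E} (hz : 0 ≤ z)
    (hf : ∀ i ∈ s, 0 ≤ f i) (h : ∀ i ∈ s, z ⊓ f i = 0) : z ⊓ ∑ i ∈ s, f i = 0 := by
  refine (Finset.sum_induction f (fun b => 0 ≤ b ∧ z ⊓ b = 0) (fun a b ha hb => ?_)
    ⟨le_rfl, inf_eq_right.2 hz⟩ fun i hi => ⟨hf i hi, h i hi⟩).2
  exact ⟨add_nonneg ha.1 hb.1, inf_add_eq_zero hz ha.1 hb.1 ha.2 hb.2⟩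

theorem inf_nsmul_eq_zero (hz : 0 ≤ z) (ha : 0 ≤ a) (h : z ⊓ a = 0) (n : ℕ) : z ⊓ n • a = 0 := by
  simpa using inf_sum_eq_zero (s := Finset.range n) hz (fun _ _ => ha) fun _ _ => h

theorem add_le_of_inf_eq_zero (h : a ⊓ b = 0) (ha : a ≤ c) (hb : b ≤ c) : a + b ≤ c := by
  rw [← inf_add_sup a b, h, zero_add]
  exact sup_le ha hb

theorem sum_le_of_pairwise_inf_eq_zero {z : ℕ → E} (hc : 0 ≤ c) (hz : ∀ n, 0 ≤ z n)
    (hzc : ∀ n, z n ≤ c) (hd : ∀ m n, m ≠ n → z m ⊓ z n = 0) (N : ℕ) :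
    ∑ n ∈ Finset.range N, z n ≤ c := by
  induction N with
  | zero => simpa using hc
  | succ N ih =>
    rw [Finset.sum_range_succ, add_comm]
    refine add_le_of_inf_eq_zero ?_ (hzc N) ih
    exact inf_sum_eq_zero (hz N) (fun i _ => hz i) fun i hi => hd _ _ (Finset.mem_range.1 hi).ne'

theorem posPart_sub_add_inf (a b : E) : (a - b)⁺ + a ⊓ b = a := by
  rw [inf_eq_sub_posPart_sub, add_sub_cancel]

theorem posPart_sub_le_left (ha : 0 ≤ a) (hb : 0 ≤ b) : (a - b)⁺ ≤ a :=
  sup_le (sub_le_self a hb) ha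

theorem posPart_add_le (a b : E) : (a + b)⁺ ≤ a⁺ + b⁺ :=
  sup_le (add_le_add (le_posPart a) (le_posPart b))
    (add_nonneg (posPart_nonneg a) (posPart_nonneg b))

end LatticeOrderedGroup

section VectorLattice

variable {E : Type*} [AddCommGroup E] [Lattice E] [Module ℝ E] [PosSMulMono ℝ E] {c : ℝ}

theorem smul_inf_of_pos (hc : 0 < c) (a b : E) : c • (a ⊓ b) = c • a ⊓ c • b :=
  (OrderIso.smulRight hc).map_inf a b

theorem smul_sup_of_pos (hc : 0 < c) (a b : E) : c • (a ⊔ b) = c • a ⊔ c • b :=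
  (OrderIso.smulRight hc).map_sup a b

theorem posPart_smul_of_pos (hc : 0 < c) (a : E) : (c • a)⁺ = c • a⁺ := by
  rw [posPart_def, posPart_def, smul_sup_of_pos hc, smul_zero]

theorem abs_smul_of_pos (hc : 0 < c) (a : E) : |c • a| = c • |a| := by
  rw [abs, abs, smul_sup_of_pos hc, smul_neg]

end VectorLattice

section PositiveFunctionals

theorem exists_linear_le_sublinear {F : Type*} [AddCommGroup F] [Module ℝ F] (N : F → ℝ)
    (N_hom : ∀ c : ℝ, 0 < c → ∀ x, N (c • x) = c * N x)
    (N_add : ∀ x y, N (x + y) ≤ N x + N y) (a : F) :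
    ∃ g : F →ₗ[ℝ] ℝ, g a = N a ∧ ∀ x, g x ≤ N x := by
  have N_zero : N 0 = 0 := by
    have := N_hom 2 two_pos 0
    rw [smul_zero] at this
    linarith
  have N_smul : ∀ c : ℝ, c * N a ≤ N (c • a) := fun c => by
    rcases lt_trichotomy c 0 with hc | rfl | hc
    · have h := N_add (c • a) (-c • a)
      rw [← add_smul, add_neg_cancel, zero_smul, N_zero, N_hom _ (neg_pos.2 hc)] at h
      linarith
    · simp [N_zero]
    · rw [N_hom c hc]
  have hspan : ∀ c : ℝ, c • a = 0 → RingHom.id ℝ c • N a = 0 := fun c hca => by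
    rcases smul_eq_zero.1 hca with rfl | rfl
    · simp
    · simp [N_zero]
  let p : F →ₗ.[ℝ] ℝ := LinearPMap.mkSpanSingleton' a (N a) hspan
  have hp : ∀ (c : ℝ) (h : c • a ∈ p.domain), p ⟨c • a, h⟩ = c * N a :=
    LinearPMap.mkSpanSingleton'_apply a (N a) hspan
  obtain ⟨g, hg, hgN⟩ := exists_extension_of_le_sublinear p N N_hom N_add (by
    rintro ⟨x, hx⟩
    obtain ⟨c, rfl⟩ := Submodule.mem_span_singleton.1 hx
    exact (hp c hx).trans_le (N_smul c))
  have ha : (1 : ℝ) • a ∈ p.domain := by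
    rw [one_smul]; exact Submodule.mem_span_singleton_self a
  exact ⟨g, by simpa using (hg ⟨_, ha⟩).trans (hp 1 ha), hgN⟩

variable {E : Type*} [NormedAddCommGroup E] [Lattice E] [IsOrderedAddMonoid E] [HasSolidNorm E]

theorem norm_le_norm_of_nonneg_of_le {a b : E} (ha : 0 ≤ a) (hab : a ≤ b) : ‖a‖ ≤ ‖b‖ :=
  norm_le_norm_of_abs_le_abs (abs_le_abs_of_nonneg ha hab)

theorem norm_posPart_le (a : E) : ‖a⁺‖ ≤ ‖a‖ :=
  (norm_le_norm_of_nonneg_of_le (posPart_nonneg a) (sup_le (le_abs_self a) (abs_nonneg a))).trans_eq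
    (norm_abs_eq_norm a)

theorem norm_posPart_add_le (a b : E) : ‖(a + b)⁺‖ ≤ ‖a⁺‖ + ‖b⁺‖ :=
  (norm_le_norm_of_nonneg_of_le (posPart_nonneg _) (posPart_add_le a b)).trans (norm_add_le _ _)

variable [NormedSpace ℝ E]

theorem exists_monotone_clm_of_le_norm_posPart (g : E →ₗ[ℝ] ℝ) {C : ℝ} (hC : 0 ≤ C)
    (h : ∀ x, g x ≤ C * ‖x⁺‖) :
    ∃ f : E →L[ℝ] ℝ, (∀ x, f x = g x) ∧ Monotone f ∧ ‖f‖ ≤ C := by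
  have hle : ∀ x, g x ≤ C * ‖x‖ := fun x =>
    (h x).trans (mul_le_mul_of_nonneg_left (norm_posPart_le x) hC)
  have hb : ∀ x, ‖g x‖ ≤ C * ‖x‖ := fun x =>
    abs_le'.2 ⟨hle x, by simpa using hle (-x)⟩
  refine ⟨g.mkContinuous C hb, fun x => rfl, ?_, g.mkContinuous_norm_le hC hb⟩
  refine (monotone_iff_map_nonneg _).2 fun x hx => ?_
  have hneg : -g x ≤ 0 := by simpa [posPart_eq_zero.2 (neg_nonpos.2 hx)] using h (-x)
  exact neg_nonpos.1 hneg

variable [IsOrderedModule ℝ E]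

theorem exists_monotone_clm_eq_norm {a : E} (ha : 0 ≤ a) :
    ∃ f : E →L[ℝ] ℝ, Monotone f ∧ ‖f‖ ≤ 1 ∧ f a = ‖a‖ := by
  obtain ⟨g, hga, hg⟩ := exists_linear_le_sublinear (fun x : E => ‖x⁺‖)
    (fun c hc x => by simp only [posPart_smul_of_pos hc, norm_smul, Real.norm_of_nonneg hc.le])
    norm_posPart_add_le a
  obtain ⟨f, hfg, hf, hnorm⟩ :=
    exists_monotone_clm_of_le_norm_posPart g zero_le_one (by simpa using hg)
  exact ⟨f, hf, hnorm, by rw [hfg, hga, posPart_of_nonneg ha]⟩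

theorem exists_monotone_sub_monotone (f : E →L[ℝ] ℝ) :
    ∃ g h : E →L[ℝ] ℝ, Monotone g ∧ Monotone h ∧ f = g - h := by
  -- The functional `(x, -x) ↦ f x` on the antidiagonal `D` is dominated by `N`, and the
  -- restrictions to the two axes of an extension dominated by `N` are positive.
  let D : Submodule ℝ (E × E) := LinearMap.ker (LinearMap.fst ℝ E E + LinearMap.snd ℝ E E)
  let p : (E × E) →ₗ.[ℝ] ℝ := ⟨D, (f.toLinearMap ∘ₗ LinearMap.fst ℝ E E).domRestrict D⟩
  let N : E × E → ℝ := fun q => ‖f‖ * (‖q.1⁺‖ + ‖q.2⁺‖)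
  have N_hom : ∀ c : ℝ, 0 < c → ∀ q, N (c • q) = c * N q := fun c hc q => by
    simp only [N, Prod.smul_fst, Prod.smul_snd, posPart_smul_of_pos hc, norm_smul,
      Real.norm_of_nonneg hc.le]
    ring
  have N_add : ∀ q r, N (q + r) ≤ N q + N r := fun q r => by
    simp only [N, Prod.fst_add, Prod.snd_add, ← mul_add]
    refine mul_le_mul_of_nonneg_left ?_ (norm_nonneg f)
    linarith [norm_posPart_add_le q.1 r.1, norm_posPart_add_le q.2 r.2]
  have p_le : ∀ q : p.domain, p q ≤ N q := by
    rintro ⟨⟨a, b⟩, hab⟩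
    obtain rfl : b = -a := (neg_eq_of_add_eq_zero_right hab).symm
    calc f a ≤ ‖f‖ * ‖a‖ := (le_abs_self _).trans (f.le_opNorm a)
      _ = ‖f‖ * ‖a⁺ - a⁻‖ := by rw [posPart_sub_negPart]
      _ ≤ ‖f‖ * (‖a⁺‖ + ‖(-a)⁺‖) := by
        rw [posPart_neg]
        exact mul_le_mul_of_nonneg_left (norm_sub_le _ _) (norm_nonneg f)
  obtain ⟨H, hH, hHN⟩ := exists_extension_of_le_sublinear p N N_hom N_add p_le
  obtain ⟨g, hgH, hg, -⟩ := exists_monotone_clm_of_le_norm_posPart (H ∘ₗ LinearMap.inl ℝ E E)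
    (norm_nonneg f) fun x => by simpa [N] using hHN (x, 0)
  obtain ⟨h, hhH, hh, -⟩ := exists_monotone_clm_of_le_norm_posPart (H ∘ₗ LinearMap.inr ℝ E E)
    (norm_nonneg f) fun x => by simpa [N] using hHN (0, x)
  refine ⟨g, h, hg, hh, ContinuousLinearMap.ext fun x => ?_⟩
  have hfH : H (x, -x) = f x := hH ⟨(x, -x), show _ ∈ D by simp [D]⟩
  have hsub : (x, -x) = LinearMap.inl ℝ E E x - LinearMap.inr ℝ E E x := by simp
  rw [sub_apply, hgH, hhH, ← hfH, hsub, map_sub]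
  rfl

variable {ι : Type*} {x y : ι → E} {l : Filter ι}

theorem weakTendsto_zero_iff_of_monotone :
    WeakTendsto x l 0 ↔
      ∀ f : E →L[ℝ] ℝ, Monotone f → Tendsto (fun i => f (x i)) l (𝓝 0) := by
  refine ⟨fun h f _ => by simpa using weakTendsto_iff.1 h f, fun h => weakTendsto_iff.2 fun f => ?_⟩
  obtain ⟨g, k, hg, hk, rfl⟩ := exists_monotone_sub_monotone f
  simpa using (h g hg).sub (h k hk)

theorem WeakTendsto.of_nonneg_of_le (hy : WeakTendsto y l 0) (hx : ∀ i, 0 ≤ x i)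
    (hxy : ∀ i, x i ≤ y i) : WeakTendsto x l 0 :=
  weakTendsto_zero_iff_of_monotone.2 fun f hf =>
    squeeze_zero (fun i => map_zero f ▸ hf (hx i)) (fun i => hf (hxy i))
      (weakTendsto_zero_iff_of_monotone.1 hy f hf)

theorem UawTendsto.of_weakTendsto_of_nonneg (h : WeakTendsto x l 0) (hx : ∀ i, 0 ≤ x i) :
    UawTendsto x l 0 := fun w hw =>
  h.of_nonneg_of_le (fun _ => le_inf (abs_nonneg _) hw) fun i => by
    rw [sub_zero, abs_of_nonneg (hx i)]
    exact inf_le_left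

end PositiveFunctionals

section SolidHull

variable {E : Type*} [NormedAddCommGroup E] [Lattice E]

theorem subset_solidClosure (S : Set E) : S ⊆ LatticeOrderedAddCommGroup.solidClosure S :=
  fun x hx => ⟨x, hx, le_rfl⟩

theorem IsLWeaklyCompact.of_subset_solidClosure [HasSolidNorm E] {A S : Set E}
    (hS : IsLWeaklyCompact S) (hA : A ⊆ LatticeOrderedAddCommGroup.solidClosure S) :
    IsLWeaklyCompact A := by
  refine ⟨?_, fun x hx hd => hS.2 x (fun n => ?_) hd⟩
  · obtain ⟨R, hR⟩ := hS.1.exists_norm_le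
    refine isBounded_iff_forall_norm_le.2 ⟨R, fun a ha => ?_⟩
    obtain ⟨s, hs, has⟩ := hA ha
    exact (norm_le_norm_of_abs_le_abs has).trans (hR s hs)
  · exact LatticeOrderedAddCommGroup.solidClosure_min hA
      (LatticeOrderedAddCommGroup.isSolid_solidClosure S) (hx n)

variable [IsOrderedAddMonoid E]

theorem IsLWeaklyCompact.of_subset_Icc [HasSolidNorm E] {A : Set E} {w : E}
    (hw : IsLWeaklyCompact {w}) (hA : A ⊆ Set.Icc 0 w) : IsLWeaklyCompact A :=
  hw.of_subset_solidClosure fun _ ha => ⟨w, rfl, abs_le_abs_of_nonneg (hA ha).1 (hA ha).2⟩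

end SolidHull

section Disjointification

theorem posPart_sub_smul_inf_posPart_sub_smul {E : Type*} [AddCommGroup E] [Lattice E]
    [IsOrderedAddMonoid E] [Module ℝ E] [IsOrderedModule ℝ E] {c : ℝ} (hc : 1 ≤ c) (a b : E) :
    (a - c • b)⁺ ⊓ (b - c⁻¹ • a)⁺ = 0 := by
  have hc0 : 0 < c := zero_lt_one.trans_le hc
  refine inf_eq_zero_of_le (posPart_nonneg _) (posPart_nonneg _) le_rfl ?_
    (posPart_inf_negPart_eq_zero (a - c • b))
  calc (b - c⁻¹ • a)⁺ = c⁻¹ • (a - c • b)⁻ := by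
        rw [← posPart_neg, ← posPart_smul_of_pos (inv_pos.2 hc0), neg_sub, smul_sub,
          inv_smul_smul₀ hc0.ne']
    _ ≤ (1 : ℝ) • (a - c • b)⁻ :=
        smul_le_smul_of_nonneg_right (inv_le_one_of_one_le₀ hc) (negPart_nonneg _)
    _ = (a - c • b)⁻ := one_smul _ _

theorem pairwise_inf_eq_zero_posPart_sub {E : Type*} [AddCommGroup E] [Lattice E]
    [IsOrderedAddMonoid E] [Module ℝ E] [IsOrderedModule ℝ E] {x : ℕ → E} {X : E}
    (hx : ∀ n, 0 ≤ x n) (hX : ∀ n, (2 : ℝ)⁻¹ ^ n • x n ≤ X) {m n : ℕ} (hmn : m < n) :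
    (x n - (4 ^ n : ℝ) • ∑ i ∈ Finset.range n, x i - (2 : ℝ)⁻¹ ^ n • X)⁺ ⊓
      (x m - (4 ^ m : ℝ) • ∑ i ∈ Finset.range m, x i - (2 : ℝ)⁻¹ ^ m • X)⁺ = 0 := by
  have hX0 : ∀ k : ℕ, 0 ≤ (2 : ℝ)⁻¹ ^ k • X := fun k =>
    smul_nonneg (by positivity) ((smul_nonneg (by positivity) (hx 0)).trans (hX 0))
  have hxm : x m ≤ ∑ i ∈ Finset.range n, x i :=
    Finset.single_le_sum (fun i _ => hx i) (Finset.mem_range.2 hmn)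
  have hpow : ((4 : ℝ) ^ n)⁻¹ ≤ 2⁻¹ ^ m * 2⁻¹ ^ n := by
    rw [← pow_add, ← inv_pow, show (4 : ℝ)⁻¹ = 2⁻¹ ^ 2 by norm_num, ← pow_mul]
    exact pow_le_pow_of_le_one (by norm_num) (by norm_num) (by lia)
  have hxn : ((4 : ℝ) ^ n)⁻¹ • x n ≤ (2 : ℝ)⁻¹ ^ m • X :=
    calc ((4 : ℝ) ^ n)⁻¹ • x n ≤ (2⁻¹ ^ m * 2⁻¹ ^ n : ℝ) • x n :=
          smul_le_smul_of_nonneg_right hpow (hx n)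
      _ = (2 : ℝ)⁻¹ ^ m • (2 : ℝ)⁻¹ ^ n • x n := mul_smul _ _ _
      _ ≤ (2 : ℝ)⁻¹ ^ m • X := smul_le_smul_of_nonneg_left (hX n) (by positivity)
  refine inf_eq_zero_of_le (posPart_nonneg _) (posPart_nonneg _) (posPart_mono ?_) (posPart_mono ?_)
    (posPart_sub_smul_inf_posPart_sub_smul (one_le_pow₀ (n := n) (by norm_num : (1 : ℝ) ≤ 4))
      (x n) (x m))
  · exact (sub_le_self _ (hX0 n)).trans
      (sub_le_sub_left (smul_le_smul_of_nonneg_left hxm (by positivity)) _)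
  · refine sub_le_sub (sub_le_self _ (smul_nonneg (by positivity) ?_)) hxn
    exact Finset.sum_nonneg fun i _ => hx i

variable {E : Type*} [NormedAddCommGroup E] [NormedSpace ℝ E] [CompleteSpace E] [Lattice E]
  [IsOrderedAddMonoid E] [IsOrderedModule ℝ E] [HasSolidNorm E]

theorem exists_forall_smul_le_of_isBounded {x : ℕ → E} (hx : ∀ n, 0 ≤ x n)
    (hb : Bornology.IsBounded (Set.range x)) : ∃ X : E, ∀ n, (2 : ℝ)⁻¹ ^ n • x n ≤ X := by
  obtain ⟨R, hR⟩ := hb.exists_norm_le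
  have hsum : Summable fun n => (2 : ℝ)⁻¹ ^ n • x n := by
    refine Summable.of_norm_bounded (g := fun n => (2 : ℝ)⁻¹ ^ n * R)
      ((summable_geometric_of_lt_one (by norm_num) (by norm_num)).mul_right R) fun n => ?_
    rw [norm_smul, Real.norm_of_nonneg (by positivity)]
    exact mul_le_mul_of_nonneg_left (hR _ ⟨n, rfl⟩) (by positivity)
  exact ⟨_, fun n => hsum.le_tsum n fun j _ => smul_nonneg (by positivity) (hx j)⟩

theorem IsLWeaklyCompact.tendsto_posPart_sub_sum {A : Set E} (hA : IsLWeaklyCompact A)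
    {x : ℕ → E} (hx : ∀ n, 0 ≤ x n) (hxA : ∀ n, x n ∈ A) :
    Tendsto (fun n => (x n - (4 ^ n : ℝ) • ∑ i ∈ Finset.range n, x i)⁺) atTop (𝓝 0) := by
  obtain ⟨X, hX⟩ := exists_forall_smul_le_of_isBounded hx (hA.1.subset (Set.range_subset_iff.2 hxA))
  set r : ℕ → E := fun n => x n - (4 ^ n : ℝ) • ∑ i ∈ Finset.range n, x i
  have hrx : ∀ n, r n - (2 : ℝ)⁻¹ ^ n • X ≤ x n := fun n =>
    (sub_le_self _ (smul_nonneg (by positivity)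
      ((smul_nonneg (by positivity) (hx 0)).trans (hX 0)))).trans
        (sub_le_self _ (smul_nonneg (by positivity) (Finset.sum_nonneg fun i _ => hx i)))
  have hnull : Tendsto (fun n => (r n - (2 : ℝ)⁻¹ ^ n • X)⁺) atTop (𝓝 0) := by
    refine hA.2 _ (fun n => ⟨x n, hxA n, ?_⟩) fun m n hmn => ?_
    · exact abs_le_abs_of_nonneg (posPart_nonneg _) (sup_le (hrx n) (hx n))
    · rw [abs_of_nonneg (posPart_nonneg _), abs_of_nonneg (posPart_nonneg _)]
      rcases hmn.lt_or_gt with h | h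
      · rw [inf_comm, pairwise_inf_eq_zero_posPart_sub hx hX h]
      · exact pairwise_inf_eq_zero_posPart_sub hx hX h
  have hX_null : Tendsto (fun n : ℕ => ‖(2 : ℝ)⁻¹ ^ n • X‖) atTop (𝓝 0) := by
    simpa using ((tendsto_pow_atTop_nhds_zero_of_lt_one (r := (2 : ℝ)⁻¹) (by norm_num)
      (by norm_num)).smul_const X).norm
  have hlim :
      Tendsto (fun n => ‖(r n - (2 : ℝ)⁻¹ ^ n • X)⁺‖ + ‖(2 : ℝ)⁻¹ ^ n • X‖) atTop (𝓝 0) := by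
    simpa only [norm_zero, add_zero] using hnull.norm.add hX_null
  refine squeeze_zero_norm (fun n => ?_) hlim
  calc ‖(r n)⁺‖ = ‖(r n - (2 : ℝ)⁻¹ ^ n • X + (2 : ℝ)⁻¹ ^ n • X)⁺‖ := by rw [sub_add_cancel]
    _ ≤ ‖(r n - (2 : ℝ)⁻¹ ^ n • X)⁺‖ + ‖(2 : ℝ)⁻¹ ^ n • X‖ :=
      (norm_posPart_add_le _ _).trans (add_le_add_right (norm_posPart_le _) _)

theorem IsLWeaklyCompact.exists_mem_closure_norm_posPart_le {A : Set E} (hA : IsLWeaklyCompact A)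
    (hA0 : ∀ a ∈ A, 0 ≤ a) {ε : ℝ} (hε : 0 < ε) :
    ∃ u ∈ AddSubmonoid.closure A, ∀ a ∈ A, ‖(a - u)⁺‖ ≤ ε := by
  by_contra! h
  choose! g hgA hg using h
  let s : ℕ → E := fun n => Nat.rec 0 (fun k t => t + g (4 ^ k • t)) n
  let x : ℕ → E := fun n => g (4 ^ n • s n)
  have hs : ∀ n, s n ∈ AddSubmonoid.closure A := fun n => by
    induction n with
    | zero => exact zero_mem _
    | succ n ih => exact add_mem ih (AddSubmonoid.subset_closure (hgA _ (nsmul_mem ih _)))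
  have hxA : ∀ n, x n ∈ A := fun n => hgA _ (nsmul_mem (hs n) _)
  have hsum : ∀ n, ∑ i ∈ Finset.range n, x i = s n := fun n =>
    Finset.sum_range_induction x s rfl n fun _ _ => rfl
  have hlow : ∀ n, ε ≤ ‖(x n - (4 ^ n : ℝ) • ∑ i ∈ Finset.range n, x i)⁺‖ := fun n => by
    have hcast : (4 ^ n : ℝ) • s n = 4 ^ n • s n := by
      rw [← Nat.cast_smul_eq_nsmul ℝ, Nat.cast_pow, Nat.cast_ofNat]
    rw [hsum, hcast]
    exact (hg _ (nsmul_mem (hs n) (4 ^ n))).le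
  have hlim := (hA.tendsto_posPart_sub_sum (fun n => hA0 _ (hxA n)) hxA).norm
  rw [norm_zero] at hlim
  exact hε.not_ge (ge_of_tendsto' hlim hlow)

end Disjointification

section TailSums

variable {E : Type*} [AddCommGroup E] [Lattice E] [IsOrderedAddMonoid E]

theorem sum_Ico_le_sum_Ico {d : ℕ → E} (hd : ∀ n, 0 ≤ d n) {M N M' N' : ℕ} (hM : M' ≤ M)
    (hN : N ≤ N') : ∑ i ∈ Finset.Ico M N, d i ≤ ∑ i ∈ Finset.Ico M' N', d i :=
  Finset.sum_le_sum_of_subset_of_nonneg (Finset.Ico_subset_Ico hM hN) fun i _ _ => hd i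

theorem exists_le_nsmul_posPart_sum_Ico_sub {d : ℕ → E} (hd : ∀ n, 0 ≤ d n) (t : E) {M : ℕ} {u : E}
    (hu : u ∈ AddSubmonoid.closure ((fun n => (d n - t)⁺) '' Set.Ici M)) :
    ∃ M' ≥ M, ∃ K : ℕ, u ≤ K • (∑ i ∈ Finset.Ico M M', d i - t)⁺ := by
  have hmono : ∀ {P Q : ℕ} (K : ℕ), P ≤ Q →
      K • (∑ i ∈ Finset.Ico M P, d i - t)⁺ ≤ K • (∑ i ∈ Finset.Ico M Q, d i - t)⁺ := fun K hPQ =>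
    nsmul_le_nsmul_right (posPart_mono (sub_le_sub_right (sum_Ico_le_sum_Ico hd le_rfl hPQ) t)) K
  induction hu using AddSubmonoid.closure_induction with
  | mem u hu =>
    obtain ⟨n, hn, rfl⟩ := hu
    refine ⟨n + 1, Nat.le_succ_of_le hn, 1, ?_⟩
    rw [one_nsmul]
    refine posPart_mono (sub_le_sub_right ?_ t)
    exact Finset.single_le_sum (fun i _ => hd i) (Finset.mem_Ico.2 ⟨hn, n.lt_succ_self⟩)
  | zero => exact ⟨M, le_rfl, 0, by rw [zero_nsmul]⟩
  | add u v _ _ ihu ihv =>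
    obtain ⟨P, hP, K, hK⟩ := ihu
    obtain ⟨Q, -, L, hL⟩ := ihv
    refine ⟨max P Q, le_max_of_le_left hP, K + L, ?_⟩
    rw [add_nsmul]
    exact add_le_add (hK.trans (hmono K (le_max_left P Q))) (hL.trans (hmono L (le_max_right P Q)))

end TailSums

theorem norm_sub_inf_le {E : Type*} [NormedAddCommGroup E] [Lattice E] [IsOrderedAddMonoid E]
    [HasSolidNorm E] {a b : E} (hba : b ≤ a) (u : E) : ‖a - b ⊓ u‖ ≤ ‖a - b‖ + ‖(a - u)⁺‖ :=
  calc ‖a - b ⊓ u‖ = ‖(a - b) + (b - u)⁺‖ := by rw [inf_eq_sub_posPart_sub, sub_add]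
    _ ≤ ‖a - b‖ + ‖(a - u)⁺‖ := (norm_add_le _ _).trans (add_le_add_right
      (norm_le_norm_of_nonneg_of_le (posPart_nonneg _) (posPart_mono (sub_le_sub_right hba u))) _)

section OrderBoundedSeries

variable {E : Type*} [NormedAddCommGroup E] [NormedSpace ℝ E] [CompleteSpace E] [Lattice E]
  [IsOrderedAddMonoid E] [IsOrderedModule ℝ E] [HasSolidNorm E] {d : ℕ → E} {t w : E}

theorem IsLWeaklyCompact.exists_norm_posPart_sub_nsmul_le (hw : IsLWeaklyCompact {w})
    (hd : ∀ n, 0 ≤ d n) (hdw : ∀ n, d n ≤ w) (ht : 0 ≤ t) (M : ℕ) {η : ℝ} (hη : 0 < η) :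
    ∃ M' ≥ M, ∃ K : ℕ, ∀ n ≥ M,
      ‖((d n - t)⁺ - K • (∑ i ∈ Finset.Ico M M', d i - t)⁺)⁺‖ ≤ η := by
  have hA : (fun n => (d n - t)⁺) '' Set.Ici M ⊆ Set.Icc 0 w := by
    rintro _ ⟨n, -, rfl⟩
    exact ⟨posPart_nonneg _, (posPart_sub_le_left (hd n) ht).trans (hdw n)⟩
  obtain ⟨u, hu, hle⟩ :=
    (hw.of_subset_Icc hA).exists_mem_closure_norm_posPart_le (fun a ha => (hA ha).1) hη
  obtain ⟨M', hM', K, hK⟩ := exists_le_nsmul_posPart_sum_Ico_sub hd t hu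
  refine ⟨M', hM', K, fun n hn => ?_⟩
  exact (norm_le_norm_of_nonneg_of_le (posPart_nonneg _)
    (posPart_mono (sub_le_sub_left hK _))).trans (hle _ ⟨n, hn, rfl⟩)

/- `R` dominates `(D - t)⁻` summed over `k` consecutive blocks `D` of the series, and up to a small
error each late `(d n - t)⁺` is disjoint from all of these. -/
theorem IsLWeaklyCompact.exists_forall_inf_eq_zero (hw : IsLWeaklyCompact {w})
    (hd : ∀ n, 0 ≤ d n) (hdw : ∀ n, d n ≤ w) (ht : 0 ≤ t) {η : ℝ} (hη : 0 < η) (k : ℕ) :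
    ∃ (M : ℕ) (R : E), 0 ≤ R ∧ k • t - ∑ i ∈ Finset.range M, d i ≤ R ∧
      ∀ n ≥ M, ∃ z, 0 ≤ z ∧ z ≤ (d n - t)⁺ ∧ z ⊓ R = 0 ∧ ‖(d n - t)⁺ - z‖ ≤ k * η := by
  induction k with
  | zero =>
    refine ⟨0, 0, le_rfl, by simp, fun n _ => ?_⟩
    exact ⟨_, posPart_nonneg _, le_rfl, inf_eq_right.2 (posPart_nonneg _), by simp⟩
  | succ k ih =>
    obtain ⟨M, R, hR, hkR, hz⟩ := ih
    obtain ⟨M', hM', K, hK⟩ := hw.exists_norm_posPart_sub_nsmul_le hd hdw ht M hη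
    set D := ∑ i ∈ Finset.Ico M M', d i
    have hu : 0 ≤ K • (D - t)⁺ := nsmul_nonneg (posPart_nonneg _) K
    refine ⟨M', R + (D - t)⁻, add_nonneg hR (negPart_nonneg _), ?_, fun n hn => ?_⟩
    · calc (k + 1) • t - ∑ i ∈ Finset.range M', d i
          = (k • t - ∑ i ∈ Finset.range M, d i) + -(D - t) := by
            rw [← Finset.sum_range_add_sum_Ico d hM', succ_nsmul]; abel
        _ ≤ R + (D - t)⁻ := add_le_add hkR (neg_le_negPart _)
    · obtain ⟨z, hz0, hzle, hzR, hzη⟩ := hz n (hM'.trans hn)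
      have hzu : 0 ≤ z ⊓ K • (D - t)⁺ := le_inf hz0 hu
      have hu_disj : K • (D - t)⁺ ⊓ (D - t)⁻ = 0 := by
        rw [inf_comm]
        refine inf_nsmul_eq_zero (negPart_nonneg _) (posPart_nonneg _) ?_ K
        rw [inf_comm, posPart_inf_negPart_eq_zero]
      refine ⟨z ⊓ K • (D - t)⁺, hzu, inf_le_left.trans hzle, ?_, ?_⟩
      · refine inf_add_eq_zero hzu hR (negPart_nonneg _)
          (inf_eq_zero_of_le hzu hR inf_le_left le_rfl hzR)
          (inf_eq_zero_of_le hzu (negPart_nonneg _) inf_le_right le_rfl hu_disj)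
      · push_cast
        linarith [norm_sub_inf_le hzle (K • (D - t)⁺), hK n (hM'.trans hn)]

theorem IsLWeaklyCompact.tendsto_zero_of_sum_le (hw : IsLWeaklyCompact {w}) (hd : ∀ n, 0 ≤ d n)
    (hdw : ∀ N, ∑ n ∈ Finset.range N, d n ≤ w) : Tendsto d atTop (𝓝 0) := by
  have hw0 : 0 ≤ w := by simpa using hdw 0
  have hle : ∀ n, d n ≤ w := fun n =>
    (Finset.single_le_sum (fun i _ => hd i) (Finset.self_mem_range_succ n)).trans (hdw _)
  rw [Metric.tendsto_atTop]
  intro ε hε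
  obtain ⟨C, hC⟩ := exists_nat_gt (2 * ‖w‖ / ε)
  have hC0 : (0 : ℝ) < C := lt_of_le_of_lt (by positivity) hC
  set t : E := (C : ℝ)⁻¹ • w with ht
  have hCt : C • t = w := by
    rw [ht, ← Nat.cast_smul_eq_nsmul ℝ, smul_inv_smul₀ hC0.ne']
  have ht0 : 0 ≤ t := smul_nonneg (by positivity) hw0
  have htε : ‖t‖ < ε / 2 := by
    rw [ht, norm_smul, Real.norm_of_nonneg (by positivity), inv_mul_lt_iff₀ hC0]
    rw [div_lt_iff₀ hε] at hC
    linarith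
  obtain ⟨M, R, -, htR, hz⟩ := hw.exists_forall_inf_eq_zero hd hle ht0
    (η := ε / (2 * (C + 1 : ℕ))) (by positivity) (C + 1)
  have htR : t ≤ R :=
    calc t = (C + 1) • t - w := by rw [succ_nsmul, hCt]; abel
      _ ≤ (C + 1) • t - ∑ i ∈ Finset.range M, d i := sub_le_sub_left (hdw M) _
      _ ≤ R := htR
  refine ⟨M, fun n hn => ?_⟩
  obtain ⟨z, hz0, hzle, hzR, hzη⟩ := hz n hn
  have hzw : z ⊓ w = 0 := hCt ▸
    inf_nsmul_eq_zero hz0 ht0 (inf_eq_zero_of_le hz0 ht0 le_rfl htR hzR) C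
  obtain rfl : z = 0 := by
    rwa [inf_eq_left.2 ((hzle.trans (posPart_sub_le_left (hd n) ht0)).trans (hle n))] at hzw
  calc dist (d n) 0 = ‖(d n - t)⁺ + d n ⊓ t‖ := by rw [dist_zero_right, posPart_sub_add_inf]
    _ ≤ ‖(d n - t)⁺ - 0‖ + ‖t‖ := by
      rw [sub_zero]
      exact (norm_add_le _ _).trans (add_le_add_right
        (norm_le_norm_of_nonneg_of_le (le_inf (hd n) ht0) inf_le_right) _)
    _ < ε / 2 + ε / 2 := by
      refine add_lt_add_of_le_of_lt (hzη.trans_eq ?_) htε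
      field_simp
    _ = ε := add_halves ε

end OrderBoundedSeries

section OrderContinuity

/-- Order continuity of the norm, encoded by the convergence of monotone order bounded sequences;
for Banach lattices this is equivalent to `‖x i‖ → 0` for every net `x` decreasing to `0`. -/
def OrderContinuousNorm (E : Type*) [NormedAddCommGroup E] [Lattice E] : Prop :=
  ∀ x : ℕ → E, Monotone x → BddAbove (Set.range x) → ∃ a, Tendsto x atTop (𝓝 a)

variable {E : Type*} [NormedAddCommGroup E] [NormedSpace ℝ E] [CompleteSpace E] [Lattice E]
  [IsOrderedAddMonoid E] [IsOrderedModule ℝ E] [HasSolidNorm E]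

theorem orderContinuousNorm_of_isLWeaklyCompact_singleton (h : ∀ w : E, IsLWeaklyCompact {w}) :
    OrderContinuousNorm E := by
  rintro x hx ⟨w, hw⟩
  refine cauchySeq_tendsto_of_complete (Metric.cauchySeq_iff'.2 ?_)
  by_contra! hnot
  obtain ⟨ε, hε, hnot⟩ := hnot
  choose f hf hd using hnot
  let φ : ℕ → ℕ := fun n => f^[n] 0
  have hφ : ∀ n, φ (n + 1) = f (φ n) := fun n => Function.iterate_succ_apply' f n 0
  have hnull : Tendsto (fun n => x (φ (n + 1)) - x (φ n)) atTop (𝓝 0) := by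
    refine (h (w - x (φ 0))).tendsto_zero_of_sum_le (fun n => ?_) fun N => ?_
    · exact sub_nonneg.2 (hx ((hf _).trans_eq (hφ n).symm))
    · rw [Finset.sum_range_sub fun n => x (φ n)]
      exact sub_le_sub_right (hw ⟨_, rfl⟩) _
  have hlow : ∀ n, ε ≤ ‖x (φ (n + 1)) - x (φ n)‖ := fun n => by
    rw [hφ, ← dist_eq_norm]
    exact hd _
  exact hε.not_ge ((ge_of_tendsto' hnull.norm hlow).trans_eq norm_zero)

end OrderContinuity

section WeakNullSequences

variable {E : Type*} [NormedAddCommGroup E] [NormedSpace ℝ E] [Lattice E] [IsOrderedAddMonoid E]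
  [HasSolidNorm E] {w : E}

theorem OrderContinuousNorm.exists_tail_majorant (hE : OrderContinuousNorm E) {z : ℕ → E}
    (hz : ∀ n, 0 ≤ z n) (hzw : ∀ n, z n ≤ w) :
    ∃ a : ℕ → E, (∀ n, z n ≤ a n) ∧ Tendsto (fun n => a n - a (n + 1)) atTop (𝓝 0) ∧
      ∀ (f : E →L[ℝ] ℝ) (n : ℕ) (c : ℝ), Monotone f →
        (∀ N, ∑ m ∈ Finset.Ico n N, f (z m) ≤ c) → f (a n) ≤ c := by
  choose a ha using fun n => hE (fun N => (∑ m ∈ Finset.Ico n N, z m) ⊓ w)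
    (fun M N hMN => inf_le_inf_right w (sum_Ico_le_sum_Ico hz le_rfl hMN))
    ⟨w, Set.forall_mem_range.2 fun N => inf_le_right⟩
  have hza : ∀ n, z n ≤ a n := fun n =>
    ge_of_tendsto (ha n) (eventually_atTop.2 ⟨n + 1, fun N hN => le_inf
      (Finset.single_le_sum (fun i _ => hz i) (Finset.mem_Ico.2 ⟨le_rfl, hN⟩)) (hzw n)⟩)
  have hanti : Antitone a := antitone_nat_of_succ_le fun n =>
    le_of_tendsto_of_tendsto' (ha (n + 1)) (ha n) fun N =>
      inf_le_inf_right w (sum_Ico_le_sum_Ico hz n.le_succ le_rfl)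
  obtain ⟨b, hb⟩ := hE (fun n => -a n) hanti.neg
    ⟨0, Set.forall_mem_range.2 fun n => neg_nonpos.2 ((hz n).trans (hza n))⟩
  refine ⟨a, hza, ?_, fun f n c hf hc => ?_⟩
  · simpa [add_comm, sub_eq_add_neg] using (hb.comp (tendsto_add_atTop_nat 1)).sub hb
  · refine le_of_tendsto' ((f.continuous.tendsto _).comp (ha n)) fun N => ?_
    exact (hf inf_le_left).trans ((map_sum f _ _).trans_le (hc N))

variable [IsOrderedModule ℝ E] {ι : Type*} {v : ι → E} {l : Filter ι}

theorem WeakTendsto.exists_seq_norming (hv : WeakTendsto v l 0) (hv0 : ∀ i, 0 ≤ v i) {ε δ : ℝ}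
    (hfreq : ∃ᶠ i in l, ε ≤ ‖v i‖) (hδ : 0 < δ) :
    ∃ (φ : ℕ → ι) (G : ℕ → E →L[ℝ] ℝ), (∀ n, Monotone (G n)) ∧ (∀ n, ‖G n‖ ≤ 1) ∧
      (∀ n, ε ≤ G n (v (φ n))) ∧ ∀ m n, m < n → G m (v (φ n)) ≤ δ * (1 / 2 : ℝ) ^ n := by
  choose F hF_mono hF_norm hFv using fun i => exists_monotone_clm_eq_norm (hv0 i)
  -- The second component records the position in the sequence, to which the bound refers.
  obtain ⟨p, hpε, hp⟩ := exists_seq_of_forall_finset_exists (fun p : ι × ℕ => ε ≤ ‖v p.1‖)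
    (fun p q => F p.1 (v q.1) ≤ δ * (1 / 2 : ℝ) ^ q.2 ∧ p.2 < q.2) fun s _ => by
      have hev : ∀ᶠ i in l, ∀ p ∈ s, F p.1 (v i) ≤ δ * (1 / 2 : ℝ) ^ (s.sup Prod.snd + 1) :=
        (eventually_all_finset s).2 fun p _ =>
          ((weakTendsto_zero_iff_of_monotone.1 hv _ (hF_mono p.1)).eventually_le_const
            (by positivity))
      obtain ⟨i, hi, hi'⟩ := (hfreq.and_eventually hev).exists
      exact ⟨(i, s.sup Prod.snd + 1), hi, fun p hps =>
        ⟨hi' p hps, Nat.lt_succ_of_le (Finset.le_sup (f := Prod.snd) hps)⟩⟩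
  have hp_mono : StrictMono fun n => (p n).2 := fun m n hmn => (hp m n hmn).2
  refine ⟨fun n => (p n).1, fun n => F (p n).1, fun n => hF_mono _, fun n => hF_norm _,
    fun n => (hpε n).trans (hFv _).ge, fun m n hmn => (hp m n hmn).1.trans ?_⟩
  exact mul_le_mul_of_nonneg_left
    (pow_le_pow_of_le_one (by norm_num) (by norm_num) (hp_mono.le_apply)) hδ.le

theorem OrderContinuousNorm.tendsto_zero_of_weakTendsto (hE : OrderContinuousNorm E)
    (hv : WeakTendsto v l 0) (hv0 : ∀ i, 0 ≤ v i) (hvw : ∀ i, v i ≤ w) : Tendsto v l (𝓝 0) := by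
  rw [Metric.tendsto_nhds]
  by_contra! hnot
  obtain ⟨ε, hε, hfreq⟩ := hnot
  simp only [dist_zero_right] at hfreq
  obtain ⟨φ, G, hG, hG1, hGε, hGδ⟩ := hv.exists_seq_norming hv0 hfreq (δ := ε / 4) (by positivity)
  obtain ⟨a, hza, ha, haf⟩ := hE.exists_tail_majorant (fun n => hv0 (φ n)) fun n => hvw (φ n)
  have hGa : ∀ n, G n (a (n + 1)) ≤ ε / 2 := fun n => haf _ _ _ (hG n) fun N =>
    calc ∑ m ∈ Finset.Ico (n + 1) N, G n (v (φ m))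
        ≤ ∑ m ∈ Finset.Ico (n + 1) N, ε / 4 * (1 / 2 : ℝ) ^ m :=
          Finset.sum_le_sum fun m hm => hGδ n m (Finset.mem_Ico.1 hm).1
      _ ≤ ∑ m ∈ Finset.range N, ε / 4 * (1 / 2 : ℝ) ^ m := by
          rw [Finset.range_eq_Ico]
          exact sum_Ico_le_sum_Ico (fun _ => by positivity) (Nat.zero_le _) le_rfl
      _ = ε / 4 * ∑ m ∈ Finset.range N, (1 / 2 : ℝ) ^ m := (Finset.mul_sum _ _ _).symm
      _ ≤ ε / 4 * 2 := mul_le_mul_of_nonneg_left (sum_geometric_two_le N) (by positivity)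
      _ = ε / 2 := by ring
  have hlow : ∀ n, ε / 2 ≤ ‖a n - a (n + 1)‖ := fun n =>
    calc ε / 2 ≤ G n (v (φ n)) - G n (a (n + 1)) := by linarith [hGε n, hGa n]
      _ ≤ G n (a n) - G n (a (n + 1)) := sub_le_sub_right (hG n (hza n)) _
      _ = G n (a n - a (n + 1)) := (map_sub _ _ _).symm
      _ ≤ ‖G n (a n - a (n + 1))‖ := Real.le_norm_self _
      _ ≤ ‖a n - a (n + 1)‖ := (G n).le_of_opNorm_le (hG1 n) _ |>.trans_eq (one_mul _)
  exact (half_pos hε).not_ge ((ge_of_tendsto' ha.norm hlow).trans_eq norm_zero)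

end WeakNullSequences

section AlmostOrderBounded

/-- A set which lies in an order interval up to arbitrarily small norm: `A ⊆ [-u, u] + ε B` with
`u` depending on `ε`, the distance of `x` to `[-u, u]` being `‖(|x| - u)⁺‖`. -/
def AlmostOrderBounded {E : Type*} [NormedAddCommGroup E] [Lattice E] (A : Set E) : Prop :=
  ∀ ε > 0, ∃ u : E, 0 ≤ u ∧ ∀ x ∈ A, ‖(|x| - u)⁺‖ ≤ ε

variable {E : Type*} [NormedAddCommGroup E] [NormedSpace ℝ E] [Lattice E] [IsOrderedAddMonoid E]
  [IsOrderedModule ℝ E] [HasSolidNorm E] {A S : Set E}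

theorem IsLWeaklyCompact.almostOrderBounded [CompleteSpace E] (hS : IsLWeaklyCompact S)
    (hA : A ⊆ LatticeOrderedAddCommGroup.solidClosure S) : AlmostOrderBounded A := by
  intro ε hε
  have habs_nonneg : ∀ a ∈ (fun y => |y|) '' S, 0 ≤ a := by
    rintro _ ⟨y, -, rfl⟩
    exact abs_nonneg y
  have habs : IsLWeaklyCompact ((fun y => |y|) '' S) := hS.of_subset_solidClosure (by
    rintro _ ⟨y, hy, rfl⟩
    exact ⟨y, hy, (abs_abs y).le⟩)
  obtain ⟨u, hu, hle⟩ := habs.exists_mem_closure_norm_posPart_le habs_nonneg hε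
  refine ⟨u, AddSubmonoid.closure_le (S := AddSubmonoid.nonneg E) |>.2 habs_nonneg hu, ?_⟩
  intro x hx
  obtain ⟨y, hy, hxy⟩ := hA hx
  exact (norm_le_norm_of_nonneg_of_le (posPart_nonneg _)
    (posPart_mono (sub_le_sub_right hxy u))).trans (hle _ ⟨y, hy, rfl⟩)

theorem AlmostOrderBounded.tendsto_of_uawTendsto (hA : AlmostOrderBounded A)
    (hE : OrderContinuousNorm E) {ι : Type*} {x : ι → E} {l : Filter ι} {a : E}
    (hx : ∀ i, x i ∈ A) (h : UawTendsto x l a) : Tendsto x l (𝓝 a) := by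
  rw [Metric.tendsto_nhds]
  intro ε hε
  obtain ⟨u, hu, hxu⟩ := hA (ε / 2) (half_pos hε)
  have hw : 0 ≤ u + |a| := add_nonneg hu (abs_nonneg a)
  have hnull := (hE.tendsto_zero_of_weakTendsto (h _ hw) (fun i => le_inf (abs_nonneg _) hw)
    fun i => inf_le_right).norm
  have hpos : ∀ i, ‖(|x i - a| - (u + |a|))⁺‖ ≤ ε / 2 := fun i => by
    refine (norm_le_norm_of_nonneg_of_le (posPart_nonneg _) (posPart_mono ?_)).trans (hxu _ (hx i))
    rw [add_comm u, ← sub_sub]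
    refine sub_le_sub_right (sub_le_iff_le_add.2 ?_) u
    simpa [sub_eq_add_neg] using abs_add_le (x i) (-a)
  filter_upwards [hnull.eventually_lt_const (norm_zero.trans_lt (half_pos hε))] with i hi
  calc dist (x i) a = ‖(|x i - a| - (u + |a|))⁺ + |x i - a| ⊓ (u + |a|)‖ := by
        rw [posPart_sub_add_inf, norm_abs_eq_norm, dist_eq_norm]
    _ < ε / 2 + ε / 2 := (norm_add_le _ _).trans_lt (add_lt_add_of_le_of_lt (hpos i) hi)
    _ = ε := add_halves ε

end AlmostOrderBounded

section SchurProperty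

theorem abs_sign_mul_le (s : SignType) (x : ℝ) : |(s : ℝ) * x| ≤ |x| := by
  cases s <;> simp

theorem summable_sign_mul {a : ℕ → ℝ} (ha : Summable fun n => |a n|) (s : ℕ → SignType) :
    Summable fun n => (s n : ℝ) * a n :=
  Summable.of_norm_bounded ha fun n => abs_sign_mul_le (s n) (a n)

theorem continuous_tsum_sign_mul {a : ℕ → ℝ} (ha : Summable fun n => |a n|) :
    Continuous fun s : ℕ → SignType => ∑' n, (s n : ℝ) * a n := by
  refine continuous_tsum (fun n => ?_) ha fun n s => abs_sign_mul_le (s n) (a n)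
  exact (continuous_of_discreteTopology (f := fun c : SignType => (c : ℝ) * a n)).comp
    (continuous_apply n)

theorem exists_tsum_abs_le_abs_tsum_sign_mul_add {a : ℕ → ℝ} (ha : Summable fun n => |a n|)
    (I : Finset ℕ) (s : ℕ → SignType) :
    ∃ r : ℕ → SignType, (∀ n ∈ I, r n = s n) ∧
      ∑' n, |a n| ≤ |∑' n, (r n : ℝ) * a n| + 2 * ∑ n ∈ I, |a n| := by
  let r : ℕ → SignType := fun n => if n ∈ I then s n else SignType.sign (a n)
  have hr : ∀ n ∉ I, |a n| - r n * a n = 0 := fun n hn => by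
    simp only [r, if_neg hn, sign_mul_self, sub_self]
  have hsub : ∑' n, |a n| - ∑' n, (r n : ℝ) * a n = ∑ n ∈ I, (|a n| - r n * a n) := by
    rw [← ha.tsum_sub (summable_sign_mul ha r), tsum_eq_sum hr]
  have hI : ∑ n ∈ I, (|a n| - r n * a n) ≤ 2 * ∑ n ∈ I, |a n| := by
    rw [Finset.mul_sum]
    refine Finset.sum_le_sum fun n _ => ?_
    linarith [neg_abs_le (r n * a n : ℝ), abs_sign_mul_le (r n) (a n)]
  exact ⟨r, fun n hn => if_pos hn, by linarith [le_abs_self (∑' n, (r n : ℝ) * a n)]⟩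

variable {a : ℕ → ℕ → ℝ}

/- Baire category on the compact space of sign patterns. -/
theorem exists_finset_forall_abs_tsum_sign_mul_le (ha : ∀ j, Summable fun n => |a j n|)
    (h : ∀ s : ℕ → SignType, Tendsto (fun j => ∑' n, (s n : ℝ) * a j n) atTop (𝓝 0))
    {ε : ℝ} (hε : 0 < ε) :
    ∃ (J : ℕ) (I : Finset ℕ) (s : ℕ → SignType), ∀ j ≥ J, ∀ r : ℕ → SignType,
      (∀ n ∈ I, r n = s n) → |∑' n, (r n : ℝ) * a j n| ≤ ε := by
  let D : ℕ → Set (ℕ → SignType) := fun J => ⋂ j ≥ J, {s | |∑' n, (s n : ℝ) * a j n| ≤ ε}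
  have hD_closed : ∀ J, IsClosed (D J) := fun J => isClosed_biInter fun j _ =>
    isClosed_le (continuous_tsum_sign_mul (ha j)).abs continuous_const
  have hD_univ : ⋃ J, D J = Set.univ := Set.eq_univ_of_forall fun s => by
    obtain ⟨J, hJ⟩ := eventually_atTop.1 ((h s).abs.eventually_le_const (abs_zero.trans_lt hε))
    exact Set.mem_iUnion.2 ⟨J, Set.mem_iInter₂.2 hJ⟩
  obtain ⟨J, s, hs⟩ := nonempty_interior_of_iUnion_of_closed hD_closed hD_univ
  obtain ⟨I, V, hV, hIV⟩ := isOpen_pi_iff.1 isOpen_interior s hs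
  refine ⟨J, I, s, fun j hj r hr => ?_⟩
  have hrD : r ∈ D J := interior_subset (hIV fun n hn => hr n hn ▸ (hV n hn).2)
  exact Set.mem_iInter₂.1 hrD j hj

theorem tendsto_tsum_abs_of_tendsto_tsum_sign_mul (ha : ∀ j, Summable fun n => |a j n|)
    (h : ∀ s : ℕ → SignType, Tendsto (fun j => ∑' n, (s n : ℝ) * a j n) atTop (𝓝 0)) :
    Tendsto (fun j => ∑' n, |a j n|) atTop (𝓝 0) := by
  have hcoord : ∀ n, Tendsto (fun j => a j n) atTop (𝓝 0) := fun n => by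
    refine (h (Pi.single n 1)).congr fun j => ?_
    rw [tsum_eq_single n fun m hm => by simp [hm]]
    simp
  have hsum : ∀ I : Finset ℕ, Tendsto (fun j => 2 * ∑ n ∈ I, |a j n|) atTop (𝓝 0) := fun I => by
    simpa using (tendsto_finsetSum I fun n _ => (hcoord n).abs).const_mul 2
  refine tendsto_order.2 ⟨fun c hc => Eventually.of_forall fun j => ?_, fun ε hε => ?_⟩
  · exact hc.trans_le (tsum_nonneg fun n => abs_nonneg _)
  · obtain ⟨J, I, s, hs⟩ := exists_finset_forall_abs_tsum_sign_mul_le ha h (half_pos hε)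
    filter_upwards [eventually_ge_atTop J, (hsum I).eventually_lt_const (half_pos hε)] with j hj hj'
    obtain ⟨r, hr, hle⟩ := exists_tsum_abs_le_abs_tsum_sign_mul_add (ha j) I s
    linarith [hs j hj r hr]

end SchurProperty

section SummableFunctionals

variable {E : Type*} [NormedAddCommGroup E] [NormedSpace ℝ E] {S : Set E} {g : ℕ → E →L[ℝ] ℝ}
  {y : ℕ → E}

theorem IsRelWeaklyCompact.exists_subseq_tendsto_apply (hS : IsRelWeaklyCompact S)
    (hy : ∀ n, y n ∈ S) (g : ℕ → E →L[ℝ] ℝ) :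
    ∃ (b : E) (φ : ℕ → ℕ), StrictMono φ ∧ ∀ f : E →L[ℝ] ℝ,
      (∀ x, (∀ n, g n x = 0) → f x = 0) → Tendsto (fun j => f (y (φ j))) atTop (𝓝 (f b)) := by
  let K : Set (WeakSpace ℝ E) := closure (toWeakSpace ℝ E '' S)
  have hyK : ∀ n, toWeakSpace ℝ E (y n) ∈ K := fun n => subset_closure ⟨_, hy n, rfl⟩
  have hg : Continuous fun (x : WeakSpace ℝ E) n => g n ((toWeakSpace ℝ E).symm x) :=
    continuous_pi fun n => continuous_eval_weakSpace (g n)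
  obtain ⟨_, ⟨b, -, rfl⟩, φ, hφ, hb⟩ :=
    (hS.image hg).tendsto_subseq fun n => ⟨_, hyK n, rfl⟩
  refine ⟨(toWeakSpace ℝ E).symm b, φ, hφ, fun f hf => tendsto_iff_ultrafilter _ _ _ |>.2 ?_⟩
  intro U hU
  obtain ⟨q, -, hq⟩ := hS.ultrafilter_le_nhds (U.map fun j => toWeakSpace ℝ E (y (φ j)))
    (le_principal_iff.2 (univ_mem' (f := (U : Filter ℕ)) fun j => hyK (φ j)))
  have hlim : ∀ k : E →L[ℝ] ℝ,
      Tendsto (fun j => k (y (φ j))) U (𝓝 (k ((toWeakSpace ℝ E).symm q))) := fun k =>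
    ((continuous_eval_weakSpace k).tendsto q).comp hq
  have hfq : f ((toWeakSpace ℝ E).symm q) = f ((toWeakSpace ℝ E).symm b) := by
    refine sub_eq_zero.1 ((map_sub f _ _).symm.trans (hf _ fun n => ?_))
    rw [map_sub, sub_eq_zero]
    exact tendsto_nhds_unique (hlim (g n)) ((tendsto_pi_nhds.1 hb n).mono_left hU)
  exact hfq ▸ hlim f

variable [CompleteSpace E]

theorem exists_clm_eq_tsum (hg : ∀ x, Summable fun n => g n x) :
    ∃ G : E →L[ℝ] ℝ, ∀ x, G x = ∑' n, g n x := by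
  have h : Tendsto (fun N x => (∑ n ∈ Finset.range N, g n) x) atTop (𝓝 fun x => ∑' n, g n x) := by
    refine tendsto_pi_nhds.2 fun x => ?_
    simpa only [sum_apply] using (hg x).hasSum.tendsto_sum_nat
  exact ⟨continuousLinearMapOfTendsto _ h, fun x => rfl⟩

theorem IsRelWeaklyCompact.tendsto_apply_zero (hS : IsRelWeaklyCompact S)
    (hg : ∀ x, Summable fun n => |g n x|) (hy : ∀ n, y n ∈ S) :
    Tendsto (fun n => g n (y n)) atTop (𝓝 0) := by
  have hG : ∀ s : ℕ → SignType, ∃ G : E →L[ℝ] ℝ, ∀ x, G x = ∑' n, (s n : ℝ) * g n x := fun s =>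
    exists_clm_eq_tsum (g := fun n => (s n : ℝ) • g n) fun x => summable_sign_mul (hg x) s
  choose G hG using hG
  refine tendsto_of_subseq_tendsto fun ψ hψ => ?_
  obtain ⟨b, φ, hφ, hb⟩ := hS.exists_subseq_tendsto_apply (fun n => hy (ψ n)) g
  have hGb : ∀ s : ℕ → SignType,
      Tendsto (fun j => ∑' n, (s n : ℝ) * g n (y (ψ (φ j)) - b)) atTop (𝓝 0) := by
    intro s
    have hs := hb (G s) fun x hx => by simp [hG, hx]
    refine (tendsto_sub_nhds_zero_iff.2 hs).congr fun j => ?_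
    rw [← map_sub, hG]
  have hsum := tendsto_tsum_abs_of_tendsto_tsum_sign_mul (fun j => hg (y (ψ (φ j)) - b)) hGb
  have hgb : Tendsto (fun j => |g (ψ (φ j)) b|) atTop (𝓝 0) :=
    (hg b).tendsto_atTop_zero.comp (hψ.comp hφ.tendsto_atTop)
  refine ⟨φ, squeeze_zero_norm (fun j => ?_) ((hsum.add hgb).trans_eq (by rw [add_zero]))⟩
  calc ‖g (ψ (φ j)) (y (ψ (φ j)))‖
      = |g (ψ (φ j)) (y (ψ (φ j)) - b) + g (ψ (φ j)) b| := by
        rw [map_sub, sub_add_cancel, Real.norm_eq_abs]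
    _ ≤ |g (ψ (φ j)) (y (ψ (φ j)) - b)| + |g (ψ (φ j)) b| := abs_add_le _ _
    _ ≤ (∑' n, |g n (y (ψ (φ j)) - b)|) + |g (ψ (φ j)) b| :=
      add_le_add_left ((hg _).le_tsum _ fun n _ => abs_nonneg _) _

end SummableFunctionals

section BandSeminorm

/-- For a positive functional `f` and `a ≥ 0`, the seminorm `y ↦ f (P |y|)` with `P` the band
projection onto the band generated by `a`. As `P` need not exist, `P |y| = sup_k (|y| ⊓ k a)` is
replaced by the supremum of the values of `f`. -/
noncomputable def bandSeminorm {E : Type*} [NormedAddCommGroup E] [NormedSpace ℝ E] [Lattice E]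
    (f : E →L[ℝ] ℝ) (a y : E) : ℝ :=
  ⨆ k : ℕ, f (|y| ⊓ k • a)

variable {E : Type*} [NormedAddCommGroup E] [NormedSpace ℝ E] [Lattice E] {f : E →L[ℝ] ℝ}

theorem bandSeminorm_neg (f : E →L[ℝ] ℝ) (a y : E) :
    bandSeminorm f a (-y) = bandSeminorm f a y := by
  simp only [bandSeminorm, abs_neg]

theorem bandSeminorm_le_apply_abs (hf : Monotone f) (a y : E) : bandSeminorm f a y ≤ f |y| :=
  ciSup_le fun _ => hf inf_le_left

theorem apply_inf_nsmul_le_bandSeminorm (hf : Monotone f) (a y : E) (k : ℕ) :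
    f (|y| ⊓ k • a) ≤ bandSeminorm f a y :=
  le_ciSup (f := fun k : ℕ => f (|y| ⊓ k • a))
    ⟨f |y|, Set.forall_mem_range.2 fun _ => hf inf_le_left⟩ k

theorem apply_le_bandSeminorm (hf : Monotone f) {x y : E} (hxy : x ≤ |y|) :
    f x ≤ bandSeminorm f x y := by
  simpa only [one_nsmul, inf_eq_right.2 hxy] using apply_inf_nsmul_le_bandSeminorm hf x y 1

variable [IsOrderedAddMonoid E] {a : E}

theorem bandSeminorm_add_le (hf : Monotone f) (ha : 0 ≤ a) (y z : E) :
    bandSeminorm f a (y + z) ≤ bandSeminorm f a y + bandSeminorm f a z := by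
  refine ciSup_le fun k => ?_
  calc f (|y + z| ⊓ k • a) ≤ f (|y| ⊓ k • a + |z| ⊓ k • a) := by
        refine hf ((inf_le_inf_right _ (abs_add_le y z)).trans ?_)
        rw [inf_comm, inf_comm |y|, inf_comm |z|]
        exact inf_add_le_add_inf (nsmul_nonneg ha k) (abs_nonneg y) (abs_nonneg z)
    _ = f (|y| ⊓ k • a) + f (|z| ⊓ k • a) := map_add f _ _
    _ ≤ bandSeminorm f a y + bandSeminorm f a z := add_le_add
        (apply_inf_nsmul_le_bandSeminorm hf a y k) (apply_inf_nsmul_le_bandSeminorm hf a z k)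

theorem tendsto_apply_inf_nsmul (hf : Monotone f) (ha : 0 ≤ a) (y : E) :
    Tendsto (fun k : ℕ => f (|y| ⊓ k • a)) atTop (𝓝 (bandSeminorm f a y)) :=
  tendsto_atTop_ciSup (fun _ _ hkl => hf (inf_le_inf_left _ (nsmul_le_nsmul_left ha hkl)))
    ⟨f |y|, Set.forall_mem_range.2 fun _ => hf inf_le_left⟩

theorem sum_bandSeminorm_le (hf : Monotone f) {x : ℕ → E} (hx : ∀ n, 0 ≤ x n)
    (hd : ∀ m n, m ≠ n → x m ⊓ x n = 0) (y : E) (N : ℕ) :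
    ∑ n ∈ Finset.range N, bandSeminorm f (x n) y ≤ f |y| := by
  refine le_of_tendsto'
    (tendsto_finsetSum _ fun n _ => tendsto_apply_inf_nsmul hf (hx n) y) fun k => ?_
  have hz : ∀ n, 0 ≤ |y| ⊓ k • x n := fun n => le_inf (abs_nonneg y) (nsmul_nonneg (hx n) k)
  have hdisj : ∀ m n, m ≠ n → (|y| ⊓ k • x m) ⊓ (|y| ⊓ k • x n) = 0 := fun m n hmn => by
    refine inf_eq_zero_of_le (hz m) (hz n) inf_le_right inf_le_right ?_
    refine inf_nsmul_eq_zero (nsmul_nonneg (hx m) k) (hx n) ?_ k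
    rw [inf_comm]
    exact inf_nsmul_eq_zero (hx n) (hx m) (hd n m hmn.symm) k
  rw [← map_sum]
  exact hf (sum_le_of_pairwise_inf_eq_zero (abs_nonneg y) hz (fun n => inf_le_left) hdisj N)

variable [IsOrderedModule ℝ E]

theorem bandSeminorm_smul_le (hf : Monotone f) (ha : 0 ≤ a) {c : ℝ} (hc : 0 < c) (y : E) :
    bandSeminorm f a (c • y) ≤ c * bandSeminorm f a y := by
  refine ciSup_le fun k => ?_
  have hk : k • a ≤ c • ⌈c⁻¹ * k⌉₊ • a := by
    rw [← Nat.cast_smul_eq_nsmul ℝ, ← Nat.cast_smul_eq_nsmul ℝ, smul_smul]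
    exact smul_le_smul_of_nonneg_right ((inv_mul_le_iff₀ hc).1 (Nat.le_ceil _)) ha
  calc f (|c • y| ⊓ k • a) ≤ f (c • (|y| ⊓ ⌈c⁻¹ * k⌉₊ • a)) := by
        rw [abs_smul_of_pos hc, smul_inf_of_pos hc]
        exact hf (inf_le_inf_left _ hk)
    _ = c * f (|y| ⊓ ⌈c⁻¹ * k⌉₊ • a) := map_smul f _ _
    _ ≤ c * bandSeminorm f a y :=
        mul_le_mul_of_nonneg_left (apply_inf_nsmul_le_bandSeminorm hf a y _) hc.le

theorem bandSeminorm_smul (hf : Monotone f) (ha : 0 ≤ a) {c : ℝ} (hc : 0 < c) (y : E) :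
    bandSeminorm f a (c • y) = c * bandSeminorm f a y := by
  refine (bandSeminorm_smul_le hf ha hc y).antisymm ?_
  have h := bandSeminorm_smul_le hf ha (inv_pos.2 hc) (c • y)
  rwa [inv_smul_smul₀ hc.ne', ← div_eq_inv_mul, le_div_iff₀' hc] at h

variable [HasSolidNorm E]

theorem exists_clm_le_bandSeminorm (hf : Monotone f) (ha : 0 ≤ a) (y : E) :
    ∃ g : E →L[ℝ] ℝ, g y = bandSeminorm f a y ∧ ∀ z, |g z| ≤ bandSeminorm f a z := by
  obtain ⟨g, hgy, hg⟩ := exists_linear_le_sublinear (bandSeminorm f a)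
    (fun c hc => bandSeminorm_smul hf ha hc) (bandSeminorm_add_le hf ha) y
  have hg_abs : ∀ z, |g z| ≤ bandSeminorm f a z := fun z =>
    abs_le'.2 ⟨hg z, by simpa [bandSeminorm_neg] using hg (-z)⟩
  refine ⟨g.mkContinuous ‖f‖ fun z => ?_, hgy, hg_abs⟩
  calc ‖g z‖ ≤ bandSeminorm f a z := hg_abs z
    _ ≤ f |z| := bandSeminorm_le_apply_abs hf a z
    _ ≤ ‖f‖ * ‖|z|‖ := (Real.le_norm_self _).trans (f.le_opNorm _)
    _ = ‖f‖ * ‖z‖ := by rw [norm_abs_eq_norm]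

variable [CompleteSpace E] {S : Set E}

theorem IsRelWeaklyCompact.weakTendsto_zero_of_disjoint (hS : IsRelWeaklyCompact S) {x : ℕ → E}
    (hx : ∀ n, 0 ≤ x n) (hxS : ∀ n, x n ∈ LatticeOrderedAddCommGroup.solidClosure S)
    (hd : ∀ m n, m ≠ n → x m ⊓ x n = 0) : WeakTendsto x atTop 0 := by
  refine weakTendsto_zero_iff_of_monotone.2 fun f hf => ?_
  choose y hyS hxy using hxS
  choose g hgy hg using fun n => exists_clm_le_bandSeminorm hf (hx n) (y n)
  have hsum : ∀ z, Summable fun n => |g n z| := fun z =>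
    summable_of_sum_range_le (fun n => abs_nonneg _) fun N =>
      (Finset.sum_le_sum fun n _ => hg n z).trans (sum_bandSeminorm_le hf hx hd z N)
  refine squeeze_zero (fun n => map_zero f ▸ hf (hx n)) (fun n => ?_)
    (hS.tendsto_apply_zero hsum hyS)
  rw [hgy]
  exact apply_le_bandSeminorm hf ((le_abs_self _).trans (hxy n))

theorem PositiveSchurProperty.isLWeaklyCompact (hE : PositiveSchurProperty E)
    (hS : IsRelWeaklyCompact S) : IsLWeaklyCompact S := by
  refine ⟨hS.isBounded, fun x hxS hd => ?_⟩
  have habs : ∀ n, |x n| ∈ LatticeOrderedAddCommGroup.solidClosure S := fun n => by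
    obtain ⟨y, hy, hxy⟩ := hxS n
    exact ⟨y, hy, (abs_abs (x n)).trans_le hxy⟩
  have h := hE (fun n => |x n|) (fun n => abs_nonneg _)
    (hS.weakTendsto_zero_of_disjoint (fun n => abs_nonneg _) habs hd)
  refine tendsto_zero_iff_norm_tendsto_zero.2 ?_
  simpa only [norm_abs_eq_norm] using tendsto_zero_iff_norm_tendsto_zero.1 h

end BandSeminorm

section UawCompact

variable {E : Type u} [NormedAddCommGroup E] [NormedSpace ℝ E] [Lattice E]

theorem UawTendsto.comp {ι κ : Type*} {x : ι → E} {l : Filter ι} {a : E} {φ : κ → ι}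
    {m : Filter κ} (h : UawTendsto x l a) (hφ : Tendsto φ m l) : UawTendsto (x ∘ φ) m a :=
  fun w hw => (h w hw).comp hφ

theorem IsUawCompact.isRelUawCompact {A : Set E} (hA : IsUawCompact A) : IsRelUawCompact A :=
  ⟨hA.1, fun ι _ _ _ x hx => (hA.2 ι x hx).imp fun _ h => h.2⟩

theorem UawTendsto.of_eventually_ne {x : ℕ → E} {a : E} (hx : UawTendsto x atTop a) {ι : Type*}
    {y : ι → E} {l : Filter ι} (hy : ∀ i, y i ∈ insert a (Set.range x))
    (hne : ∀ b ∈ insert a (Set.range x), ∀ᶠ i in l, y i ≠ b) : UawTendsto y l a := by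
  choose! n hn using fun i (hi : y i ≠ a) => (hy i).resolve_left hi
  have hyn : ∀ᶠ i in l, x (n i) = y i := (hne a (Set.mem_insert a _)).mono hn
  have hn_atTop : Tendsto n l atTop := by
    rw [← Nat.cofinite_eq_atTop]
    refine le_cofinite_iff_eventually_ne.2 fun k => eventually_map.2 ?_
    filter_upwards [hyn, hne (x k) (Set.mem_insert_of_mem a ⟨k, rfl⟩)] with i hi hik hnk
    exact hik (hnk ▸ hi.symm)
  refine fun w hw => Tendsto.congr' ?_ ((hx.comp hn_atTop) w hw)
  filter_upwards [hyn] with i hi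
  rw [Function.comp_apply, hi]

variable [IsOrderedAddMonoid E]

theorem hasSubnetUawTendsto_of_frequently_eq {ι : Type u} [Preorder ι] [IsDirected ι (· ≤ ·)]
    [Nonempty ι] {y : ι → E} {b : E} (h : ∃ᶠ i in atTop, y i = b) : HasSubnetUawTendsto y b := by
  rw [frequently_atTop] at h
  refine ⟨{i // y i = b}, inferInstance, ⟨fun i j => ?_⟩, ?_, Subtype.val, ?_, fun w hw => ?_⟩
  · obtain ⟨k, hik, hjk⟩ := directed_of (· ≤ ·) i.1 j.1
    obtain ⟨m, hkm, hm⟩ := h k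
    exact ⟨⟨m, hm⟩, hik.trans hkm, hjk.trans hkm⟩
  · obtain ⟨m, -, hm⟩ := h (Classical.arbitrary ι)
    exact ⟨⟨m, hm⟩⟩
  · refine tendsto_atTop.2 fun i => ?_
    obtain ⟨m, him, hm⟩ := h i
    filter_upwards [eventually_ge_atTop (⟨m, hm⟩ : {i // y i = b})] with k hk
    exact him.trans hk
  · refine weakTendsto_of_tendsto (tendsto_const_nhds.congr fun k => ?_)
    rw [Function.comp_apply, k.2, sub_self, abs_zero, inf_eq_left.2 hw]

theorem isUawCompact_insert_range {x : ℕ → E} {a : E}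
    (hb : Bornology.IsBounded (insert a (Set.range x))) (hx : UawTendsto x atTop a) :
    IsUawCompact (insert a (Set.range x)) := by
  refine ⟨hb, fun ι _ _ _ y hy => ?_⟩
  by_cases h : ∃ b ∈ insert a (Set.range x), ∃ᶠ i in atTop, y i = b
  · obtain ⟨b, hbA, hfreq⟩ := h
    exact ⟨b, hbA, hasSubnetUawTendsto_of_frequently_eq hfreq⟩
  · push Not at h
    exact ⟨a, Set.mem_insert a _, ι, inferInstance, inferInstance, inferInstance, id, tendsto_id,
      hx.of_eventually_ne hy h⟩

variable [IsOrderedModule ℝ E] [HasSolidNorm E] {A : Set E}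

theorem positiveSchurProperty_of_isCompact_closure
    (h : ∀ A : Set E, IsRelWeaklyCompact A → IsUawCompact A → IsCompact (closure A)) :
    PositiveSchurProperty E := by
  intro x hx0 hx
  have hS := isRelWeaklyCompact_insert_range hx
  have hK := h _ hS (isUawCompact_insert_range hS.isBounded (.of_weakTendsto_of_nonneg hx hx0))
  refine tendsto_of_subseq_tendsto fun ψ hψ => ?_
  obtain ⟨a, -, φ, hφ, ha⟩ := hK.tendsto_subseq (x := x ∘ ψ)
    fun n => subset_closure (Set.mem_insert_of_mem 0 ⟨ψ n, rfl⟩)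
  exact ⟨φ, ((hx.comp hψ).comp hφ.tendsto_atTop).eq_of_tendsto ha ▸ ha⟩

theorem AlmostOrderBounded.exists_subseq_tendsto (hA : AlmostOrderBounded A)
    (hE : OrderContinuousNorm E) {x : ℕ → E} (hx : ∀ n, x n ∈ A) {a : E}
    (h : HasSubnetUawTendsto (fun i : ULift.{u} ℕ => x i.down) a) :
    ∃ φ : ℕ → ℕ, StrictMono φ ∧ Tendsto (x ∘ φ) atTop (𝓝 a) := by
  obtain ⟨κ, _, _, _, φ, hφ, hu⟩ := h
  have hlim := hA.tendsto_of_uawTendsto hE (fun k => hx (φ k).down) hu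
  exact (hlim.mapClusterPt.of_comp (ULift.orderIso.tendsto_atTop.comp hφ)).tendsto_subseq

theorem AlmostOrderBounded.isCompact (hA : AlmostOrderBounded A) (hE : OrderContinuousNorm E)
    (h : IsUawCompact A) : IsCompact A := by
  refine IsSeqCompact.isCompact fun x hx => ?_
  obtain ⟨a, ha, hsub⟩ := h.2 (ULift.{u} ℕ) (fun i => x i.down) fun i => hx _
  exact ⟨a, ha, hA.exists_subseq_tendsto hE hx hsub⟩

theorem AlmostOrderBounded.isCompact_closure (hA : AlmostOrderBounded A)
    (hE : OrderContinuousNorm E) (h : IsRelUawCompact A) : IsCompact (closure A) := by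
  refine IsSeqCompact.isCompact fun z hz => ?_
  choose x hx hd using fun n : ℕ =>
    Metric.mem_closure_iff.1 (hz n) (1 / ((n : ℝ) + 1)) Nat.one_div_pos_of_nat
  obtain ⟨a, hsub⟩ := h.2 (ULift.{u} ℕ) (fun i => x i.down) fun i => hx _
  obtain ⟨φ, hφ, ha⟩ := hA.exists_subseq_tendsto hE hx hsub
  refine ⟨a, mem_closure_of_tendsto ha (Eventually.of_forall fun n => hx _), φ, hφ, ?_⟩
  refine ha.congr_dist (squeeze_zero (fun _ => dist_nonneg) (fun n => ?_)
    (tendsto_one_div_add_atTop_nhds_zero_nat.comp hφ.tendsto_atTop))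
  rw [dist_comm]
  exact (hd (φ n)).le

end UawCompact

end BanachLattice

theorem corollary3p19 (E : Type u) [NormedAddCommGroup E] [NormedSpace ℝ E]
    [CompleteSpace E] [Lattice E] [IsOrderedAddMonoid E] [IsOrderedModule ℝ E] [HasSolidNorm E] :
    List.TFAE [
      BanachLattice.PositiveSchurProperty E,
      ∀ S : Set E, BanachLattice.IsRelWeaklyCompact S → BanachLattice.IsLWeaklyCompact S,
      ∀ S : Set E, BanachLattice.IsRelWeaklyCompact S →
        ∀ (ι : Type v) [Preorder ι] [IsDirected ι (· ≤ ·)] [Nonempty ι] (x : ι → E),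
          (∀ i, x i ∈ LatticeOrderedAddCommGroup.solidClosure S) →
          BanachLattice.UawTendsto x atTop 0 → Tendsto x atTop (𝓝 0),
      ∀ S : Set E, BanachLattice.IsRelWeaklyCompact S →
        ∀ x : ℕ → E, (∀ n, x n ∈ LatticeOrderedAddCommGroup.solidClosure S) →
          BanachLattice.UawTendsto x atTop 0 → Tendsto x atTop (𝓝 0),
      ∀ S : Set E, BanachLattice.IsRelWeaklyCompact S →
        ∀ A : Set E, A ⊆ LatticeOrderedAddCommGroup.solidClosure S →
          BanachLattice.IsUawCompact A → IsCompact A,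
      ∀ S : Set E, BanachLattice.IsRelWeaklyCompact S →
        ∀ A : Set E, A ⊆ LatticeOrderedAddCommGroup.solidClosure S →
          BanachLattice.IsRelUawCompact A → IsCompact (closure A)] := by
  have hE (h : ∀ S : Set E, BanachLattice.IsRelWeaklyCompact S →
      BanachLattice.IsLWeaklyCompact S) : BanachLattice.OrderContinuousNorm E :=
    BanachLattice.orderContinuousNorm_of_isLWeaklyCompact_singleton fun w =>
      h _ (BanachLattice.isRelWeaklyCompact_singleton w)
  tfae_have 1 → 2 := fun h S hS => h.isLWeaklyCompact hS
  tfae_have 2 → 3 := fun h S hS ι _ _ _ x hx hu =>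
    ((h S hS).almostOrderBounded subset_rfl).tendsto_of_uawTendsto (hE h) hx hu
  tfae_have 3 → 4 := fun h S hS x hx hu =>
    let e : ULift.{v} ℕ ≃o ℕ := ULift.orderIso
    (h S hS _ (x ∘ e) (fun _ => hx _) (hu.comp e.tendsto_atTop)).comp e.symm.tendsto_atTop
  tfae_have 4 → 1 := fun h x hx0 hx =>
    h _ (BanachLattice.isRelWeaklyCompact_insert_range hx) x
      (fun n => BanachLattice.subset_solidClosure _ (Set.mem_insert_of_mem 0 ⟨n, rfl⟩))
      (.of_weakTendsto_of_nonneg hx hx0)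
  tfae_have 2 → 5 := fun h S hS A hA hu => ((h S hS).almostOrderBounded hA).isCompact (hE h) hu
  tfae_have 5 → 1 := fun h => BanachLattice.positiveSchurProperty_of_isCompact_closure
    fun A hA hu => (h A hA A (BanachLattice.subset_solidClosure A) hu).closure
  tfae_have 2 → 6 := fun h S hS A hA hu =>
    ((h S hS).almostOrderBounded hA).isCompact_closure (hE h) hu
  tfae_have 6 → 1 := fun h => BanachLattice.positiveSchurProperty_of_isCompact_closure
    fun A hA hu => h A hA A (BanachLattice.subset_solidClosure A) hu.isRelUawCompact
  tfae_finish
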